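/- **Setting.** Let $G$ be a connected undirected graph on a finite set $V$ of $n$ agents with pairwise distinct identifiers in $\mathbb N$; agent $i$ holds an observation $x_i\in\mathbb R^d$ ($d\ge1$). All agents know a common integer $\tilde n\ge n$. Let $k\ge1$ be the number of clusters, $M\ge1$ the maximal number of steps, and $c_1(0),\dots,c_k(0)\in\mathbb R^d$ arbitrary initial centroids. Ties in nearest-centroid choices are broken by an arbitrary rule that selects, for each observation and each iteration, an element of the set of minimizers; both algorithms use the same rule. **Centralized $k$-means.** For $T=0,1,2,\dots$: put $a_i(T)\in\arg\min_j\|x_i-c_j(T)\|^2$, $r_{ij}(T)=1$ if $j=a_i(T)$ and $0$ otherwise, and $c_j(T+1)=\sum_i r_{ij}(T)x_i/\sum_i r_{ij}(T)$. If cluster $j$ is empty, $c_j(T+1)$ is undefined and is treated as infinitely far from every observation. **Consensus procedures.** Let $H$ be an undirected graph on $V$ with neighbourhoods $\mathcal N_i$, and let agent $i$ use the integer $N_i$ as a bound on the number of agents. - *Max-consensus:* agent $i$ returns $z_i(N_i)$, where $z_i(t+1)=\max_{j\in\mathcal N_i\cup\{i\}}z_j(t)$, component-wise, with values $-\infty$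 allowed. - *Finite-time average consensus:* states follow $z_i(t+1)=w_{ii}z_i(t)+\sum_{j\in\mathcal N_i}w_{ij}z_j(t)$ with $w_{ij}=1/N_i$ for $j\in\mathcal N_i$ and $w_{ii}=1-\sum_{j\in\mathcal N_i}w_{ij}$. This is first run from preparatory scalar initial conditions $z_{*,1},z_{*,2},\dots\in\mathbb R^V$, of which the first $n$ are linearly independent and which are otherwise arbitrary (they may differ from call to call). Let $\zeta_i(s)\in\mathbb R^{N_i}$ be the vector of the values of agent $i$ at time $s$ in the runs $1,\dots,N_i$. Agent $i$ finds the least $\delta_i\ge0$ for which $\zeta_i(0),\dots,\zeta_i(\delta_i+1)$ are linearly dependent, a monic polynomial $q_i(g)=\sum_{s\le\delta_i+1}\alpha_{i,s}g^s$ of degree $\delta_i+1$ with $\sum_s\alpha_{i,s}\zeta_i(s)=0$, and $p_i(g)=q_i(g)/(g-1)=\sum_{s\le\delta_i}\beta_{i,s}g^s$. It returns $\sum_{s\le\delta_i}\frac{\beta_{i,s}}{p_i(1)}z_i(s)$, where $z$ is the run from the actual (scalar or vector) initial condition. **Distributed $k$-means** (all agents act synchronously). *Initialization, with bound $\tilde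 n$:* the leader is the agent whose identifier equals the result of max-consensus of the identifiers over $G$; $n_i$ is the reciprocal of the finite-time average consensus over $G$ of the indicator of the leader. Agent $i$ uses $\lfloor n_i\rfloor$ as its bound from now on. The leader sets $c_{ij}=c_j(0)$ for all $j$; the other agents set $c_{ij}=(-\infty,\dots,-\infty)$. *Step $T=1,2,\dots$:* 1. Propagation: max-consensus over $G$ of $c_i^0\in[-\infty,\infty]^{kd}$, where $c_i^0=(c_{ij})_j$ if $T=1$, while for $T>1$ the vector $c_i^0$ has $j$-th block $c_{ij}$ for $j=\bar j_i(T-1)$ and all other blocks $-\infty$. The result is $c_i^{\rm rec}(T)=(c_{ij}^{\rm rec}(T))_j$. 2. Choice: $\bar j_i(T)\in\arg\min_j|c^{\rm rec}_{ij}(T)-x_i|$, the distance being $\infty$ if $c^{\rm rec}_{ij}(T)$ is not finite. Let $\mathcal N_i^c(T)$ be the neighbours of $i$ in $G$ with the same choice, and $G^c(T)$ the subgraph of $G$ with these neighbourhoods. 3. Sub-clusters: over $G^c(T)$, $SCC_i$ is the finite-time average consensus of the $x_j$; $i$ is a sub-cluster leader if the max-consensus of the identifiers returns its own; $SCS_i$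 is the reciprocal of the finite-time average consensus of the indicator of the sub-cluster leaders. 4. Centroids: finite-time average consensus over $G$ of the vectors $\eta_i^0\in(\mathbb R^{d}\times\mathbb R)^k$ whose block $\bar j_i(T)$ is $(SCS_i\,SCC_i,\,SCS_i)$ if $i$ is a sub-cluster leader, all other blocks (and all blocks of non-leaders) being $0$. If block $j$ of the result at agent $i$ is $(\bar\sigma_j,\bar\epsilon_j)$, then $c_{ij}(T)=\bar\sigma_j/\bar\epsilon_j$, with the value $(-\infty,\dots,-\infty)$, meaning undefined, if $\bar\epsilon_j=0$. 5. Exit test of agent $i$. Method $C_1$: exit if the max-consensus over $G$ of the indicators of $\bar j_i(T)\ne\bar j_i(T-1)$ is $0$, where $\bar j_i(0)$ is not a cluster index. Method $C_2$: let $\bar\nu_i(T)$ be the finite-time average consensus over $G$ of $n_i\|c_{i\bar j_i(T)}(T)-x_i\|^2$; for $T\ge2$ exit if $\bar\nu_i(T)-\bar\nu_i(T-1)<\Delta_{\max}$ (or, in a variant, if $|\bar\nu_i(T)-\bar\nu_i(T-1)|<\Delta_{\max}$). An agent stops, and returns $c_{i1}(T),\dots,c_{ik}(T)$, $\bar j_i(T)$,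 $\mathcal N_i^c(T)$, after the first step $T$ with $T\ge M$ or with its exit test satisfied. Centralized $k$-means stops by the same rule: step $T\ge1$ is its iteration $T-1$. Under $C_1$ it exits if $T\ge2$ and $a(T-1)=a(T-2)$. Under $C_2$ it exits if $T\ge2$ and $D_T-D_{T-1}<\Delta_{\max}$ (respectively $|D_T-D_{T-1}|<\Delta_{\max}$), where $D_T=\sum_{i,j}r_{ij}(T-1)\|x_i-c_j(T)\|^2$. **Theorem.** For every step $T\ge1$ and every agent $i$ (steps being continued formally past the stopping time): - $c^{\rm rec}_{ij}(T)=c_j(T-1)$, $\ \bar j_i(T)=a_i(T-1)$ and $c_{ij}(T)=c_j(T)$ for all $j$, where an undefined centroid is represented by $(-\infty,\dots,-\infty)$; - the objective has the same value for both algorithms, before and after refinement of the centroids: $\sum_i\|x_i-c^{\rm rec}_{i\bar j_i(T)}(T)\|^2=\sum_{i,j}r_{ij}(T-1)\|x_i-c_j(T-1)\|^2$ and $\sum_i\|x_i-c_{i\bar j_i(T)}(T)\|^2=\sum_{i,j}r_{ij}(T-1)\|x_i-c_j(T)\|^2$ (undefined centroids, to which no observation is assigned, contribute $0$); - the exit test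 of agent $i$ is satisfied at step $T$ if and only if that of centralized $k$-means is. Consequently all agents stop at the same step $T^*$ as centralized $k$-means, and agent $i$ returns the centroids $c_1(T^*),\dots,c_k(T^*)$, its assignment $a_i(T^*-1)$, and the set of its neighbours in $G$ with the same assignment. -/

import Mathlib

namespace DistKMeans

noncomputable section

open Classical in
/-- Neighbourhood of agent `i` in the communication graph `H`. -/
def nbhd {V : Type*} [Fintype V] (H : SimpleGraph V) (i : V) : Finset V :=
  Finset.univ.filter fun j => H.Adj i j

/-! ### Max-consensus -/

open Classical in
/-- One synchronous round of max-consensus: every agent takes the (component-wise) maximum over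
its neighbourhood and itself. -/
def maxRound {V α : Type*} [Fintype V] [SemilatticeSup α] (H : SimpleGraph V) (z : V → α) :
    V → α :=
  fun i => (insert i (nbhd H i)).sup' (Finset.insert_nonempty _ _) z

/-- `maxConsensus H N z₀ i` is the state of agent `i` after the `N i` rounds it executes. -/
def maxConsensus {V α : Type*} [Fintype V] [SemilatticeSup α] (H : SimpleGraph V) (N : V → ℕ)
    (z₀ : V → α) (i : V) : α :=
  ((maxRound H)^[N i] z₀) i

/-! ### Finite-time average-consensus -/

/-- Weight `1 / N i` given by agent `i` to each of its neighbours. -/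
def nbrWeight {V : Type*} (N : V → ℕ) (i : V) : ℝ := 1 / (N i : ℝ)

/-- One synchronous round of the linear iteration `z_i(t+1) = w_ii z_i(t) + ∑_{j ∈ N_i} w_ij z_j(t)`
with `w_ij = 1 / N i` for neighbours `j` of `i`, and `w_ii = 1 - ∑_{l ∈ N_i} w_il`. -/
def avgRound {V E : Type*} [Fintype V] [AddCommGroup E] [Module ℝ E] (H : SimpleGraph V)
    (N : V → ℕ) (z : V → E) : V → E :=
  fun i => (1 - ∑ _l ∈ nbhd H i, nbrWeight N i) • z i + ∑ j ∈ nbhd H i, nbrWeight N i • z j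

/-- State at time `t` of the linear iteration started from `z₀`. -/
def avgIter {V E : Type*} [Fintype V] [AddCommGroup E] [Module ℝ E] (H : SimpleGraph V)
    (N : V → ℕ) (z₀ : V → E) (t : ℕ) : V → E :=
  (avgRound H N)^[t] z₀

/-- The column, indexed by the preparatory runs `j = 0, …, N i - 1`, of the values that agent `i`
observes at time `s`; run `j` starts from `prep j`. -/
def prepColumn {V : Type*} [Fintype V] (H : SimpleGraph V) (N : V → ℕ) (prep : ℕ → V → ℝ)
    (i : V) (s : ℕ) : Fin (N i) → ℝ :=
  fun j => avgIter H N (prep j) s i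

/-- The least `δ` such that the observed columns at times `0, …, δ + 1` are linearly dependent. -/
def degIndex {V : Type*} [Fintype V] (H : SimpleGraph V) (N : V → ℕ) (prep : ℕ → V → ℝ)
    (i : V) : ℕ :=
  sInf {δ : ℕ | ¬ LinearIndependent ℝ fun s : Fin (δ + 2) => prepColumn H N prep i s}

/-- The polynomial `q_i` computed by agent `i`: monic of degree `δ_i + 1`, with coefficients in the
null space of the matrix of observed columns. -/
def agentPoly {V : Type*} [Fintype V] (H : SimpleGraph V) (N : V → ℕ) (prep : ℕ → V → ℝ)
    (i : V) : Polynomial ℝ :=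
  Classical.epsilon fun q : Polynomial ℝ =>
    q.Monic ∧ q.natDegree = degIndex H N prep i + 1 ∧
      ∑ s ∈ Finset.range (degIndex H N prep i + 2), q.coeff s • prepColumn H N prep i s = 0

/-- `p_i(g) = q_i(g) / (g - 1)`. -/
def agentQuot {V : Type*} [Fintype V] (H : SimpleGraph V) (N : V → ℕ) (prep : ℕ → V → ℝ)
    (i : V) : Polynomial ℝ :=
  agentPoly H N prep i /ₘ (Polynomial.X - Polynomial.C 1)

/-- Value returned to agent `i` by the finite-time average-consensus procedure on `H` with bounds
`N`, preparatory initial conditions `prep` and initial states `z₀`: the combination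
`∑_{s ≤ δ_i} γ_{i,s} z_i(s)` with `γ_{i,s} = β_{i,s} / p_i(1)`, where the `β_{i,s}` are the
coefficients of `p_i`. -/
def ftaConsensus {V E : Type*} [Fintype V] [AddCommGroup E] [Module ℝ E] (H : SimpleGraph V)
    (N : V → ℕ) (prep : ℕ → V → ℝ) (z₀ : V → E) (i : V) : E :=
  ∑ s ∈ Finset.range (degIndex H N prep i + 1),
    ((agentQuot H N prep i).coeff s / (agentQuot H N prep i).eval 1) • avgIter H N z₀ s i

/-! ### Data of a run -/

/-- Exit methods: no change of the assignments; small difference (signed, or in absolute value) of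
two successive values of the objective. -/
inductive ExitRule where
  | assignments : ExitRule
  | objective (Δ : ℝ) : ExitRule
  | objectiveAbs (Δ : ℝ) : ExitRule

/-- The places at which finite-time average-consensus is executed (`T` is the step number). -/
inductive FTACall where
  | networkSize : FTACall
  | subCentroid (T : ℕ) : FTACall
  | subSize (T : ℕ) : FTACall
  | centroid (T : ℕ) : FTACall
  | exitValue (T : ℕ) : FTACall

/-- Data of a run with agents `V`, observations in `ℝ^d` and `k` clusters. -/
structure Data (V : Type*) (d k : ℕ) where
  /-- communication graph (undirected) -/
  graph : SimpleGraph V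
  /-- identifiers of the agents -/
  uid : V → ℕ
  /-- known upper bound on the number of agents -/
  nBound : ℕ
  /-- observations -/
  x : V → EuclideanSpace ℝ (Fin d)
  /-- initial centroids (selected by the leader in the distributed algorithm) -/
  cInit : Fin k → EuclideanSpace ℝ (Fin d)
  /-- initial conditions of the preparatory runs in each finite-time average-consensus -/
  prep : FTACall → ℕ → V → ℝ
  /-- choice, at step `T` and for observation `i`, of an element of the set of nearest centroids -/
  tie : ℕ → V → Finset (Fin k) → Fin k
  /-- exit method -/
  rule : ExitRule
  /-- maximal number of iterations -/
  M : ℕ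

/-- Number of executed steps of a loop whose exit flag after step `T = 1, 2, …` is `e T`, and that
executes at most `M` steps. -/
def stopStep (M : ℕ) (e : ℕ → Prop) : ℕ := sInf {T : ℕ | 1 ≤ T ∧ (M ≤ T ∨ e T)}

open Classical in
/-- Set of minimizers of `f`. -/
def argminSet {k : ℕ} (f : Fin k → EReal) : Finset (Fin k) :=
  Finset.univ.filter fun j => ∀ j', f j ≤ f j'

/-- Assignment variable `r_ij` attached to the cluster index `a` of observation `i`. -/
def r {k : ℕ} (a j : Fin k) : ℝ := if a = j then 1 else 0

/-! ### Centralized `k`-means -/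

/-- Squared distance to a centroid; a centroid which is undefined, because its cluster was empty, is
infinitely far. -/
def sqDist {d : ℕ} (y : EuclideanSpace ℝ (Fin d)) : Option (EuclideanSpace ℝ (Fin d)) → EReal
  | none => ⊤
  | some c => ((‖y - c‖ ^ 2 : ℝ) : EReal)

/-- Refinement: the mean of the observations of each cluster, `none` for an empty cluster (for which
the quotient is undefined). -/
def refine {V : Type*} [Fintype V] {d k : ℕ} (x : V → EuclideanSpace ℝ (Fin d)) (a : V → Fin k) :
    Fin k → Option (EuclideanSpace ℝ (Fin d)) :=
  fun j => if ∑ i, r (a i) j = 0 then none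
    else some ((∑ i, r (a i) j)⁻¹ • ∑ i, r (a i) j • x i)

/-- Objective `D = ∑_i ∑_j r_ij ‖x_i - c_j‖²`. -/
def objective {V : Type*} [Fintype V] {d k : ℕ} (x : V → EuclideanSpace ℝ (Fin d))
    (c : Fin k → Option (EuclideanSpace ℝ (Fin d))) (a : V → Fin k) : ℝ :=
  ∑ i, ∑ j, r (a i) j * (sqDist (x i) (c j)).toReal

namespace Data

variable {V : Type*} [Fintype V] {d k : ℕ}

/-- Assignment phase: `T` is the index of the iteration, `c` the current centroids. -/
def assign (P : Data V d k) (T : ℕ) (c : Fin k → Option (EuclideanSpace ℝ (Fin d))) : V → Fin k :=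
  fun i => P.tie T i (argminSet fun j => sqDist (P.x i) (c j))

/-- Centroids `c(T)` of centralized `k`-means. -/
def kCentroid (P : Data V d k) : ℕ → Fin k → Option (EuclideanSpace ℝ (Fin d))
  | 0 => fun j => some (P.cInit j)
  | T + 1 => refine P.x (P.assign T (P.kCentroid T))

/-- Assignment at iteration `T` of centralized `k`-means, computed from `c(T)`. -/
def kAssign (P : Data V d k) (T : ℕ) : V → Fin k := P.assign T (P.kCentroid T)

/-- Objective at the end of iteration `T`, i.e. for the assignment `r(T)` and the centroids
`c(T+1)` of its clusters. -/
def kObjective (P : Data V d k) (T : ℕ) : ℝ := objective P.x (P.kCentroid (T + 1)) (P.kAssign T)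

/-- Exit flag of centralized `k`-means after `T` executed iterations (with indices `0, …, T - 1`);
there is nothing to compare with before the second one. -/
def kExit (P : Data V d k) : ℕ → Prop
  | 0 => False
  | 1 => False
  | T + 2 =>
    match P.rule with
    | .assignments => P.kAssign (T + 1) = P.kAssign T
    | .objective Δ => P.kObjective (T + 1) - P.kObjective T < Δ
    | .objectiveAbs Δ => |P.kObjective (T + 1) - P.kObjective T| < Δ

/-- Number of iterations executed by centralized `k`-means. -/
def kStop (P : Data V d k) : ℕ := stopStep P.M P.kExit

end Data

/-! ### Distributed `k`-means -/

/-- Real vectors as extended real vectors. -/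
def toExt {d : ℕ} (v : EuclideanSpace ℝ (Fin d)) : Fin d → EReal := fun l => ((v l : ℝ) : EReal)

/-- Extended real vector of a possibly undefined centroid; undefined is `(-∞, …, -∞)`. -/
def optToExt {d : ℕ} : Option (EuclideanSpace ℝ (Fin d)) → Fin d → EReal
  | none => fun _ => ⊥
  | some v => toExt v

/-- Real vector with the same finite components. -/
def ofExt {d : ℕ} (c : Fin d → EReal) : EuclideanSpace ℝ (Fin d) :=
  WithLp.toLp 2 fun l => (c l).toReal

open Classical in
/-- `|c - y|` for an extended real vector `c`; infinite when a component of `c` is. -/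
def extDist {d : ℕ} (c : Fin d → EReal) (y : EuclideanSpace ℝ (Fin d)) : EReal :=
  if ∀ l, c l ≠ ⊥ ∧ c l ≠ ⊤ then ((‖ofExt c - y‖ : ℝ) : EReal) else ⊤

/-- The variables of all agents at the end of a step of the distributed algorithm. -/
structure DState (V : Type*) (d k : ℕ) where
  /-- centroids known to each agent after the centroid propagation phase -/
  received : V → Fin k → Fin d → EReal
  /-- index of the chosen centroid (`none` before the first step) -/
  choice : V → Option (Fin k)
  /-- neighbours with the same choice -/
  cnbhd : V → Finset V
  /-- centroids known to each agent after the centroid calculation phase -/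
  centroid : V → Fin k → Fin d → EReal
  /-- value on which the exit condition is evaluated (`none` before the first step) -/
  nu : V → Option ℝ
  /-- exit flag of each agent -/
  exit : V → Prop

/-- `μ_i`: one at the chosen index, zero elsewhere. -/
def mu {k : ℕ} (a : Fin k) : Fin k → EReal := fun j => if j = a then 1 else 0

/-- `μ̂_i`: zero at the chosen index, `-∞` elsewhere. -/
def muHat {k : ℕ} (a : Fin k) : Fin k → EReal := fun j => if j = a then 0 else ⊥

/-- `μ ⊗ c + μ̂ ⊗ 1_d`. -/
def propInit {d k : ℕ} (a : Fin k) (c : Fin d → EReal) : Fin k → Fin d → EReal :=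
  fun j l => mu a j * c l + muHat a j

open Classical in
/-- `σ / ε`; this is undefined, i.e. `(-∞, …, -∞)`, if `ε = 0`. -/
def extQuot {d : ℕ} (σε : EuclideanSpace ℝ (Fin d) × ℝ) : Fin d → EReal :=
  if σε.2 = 0 then fun _ => ⊥ else toExt (σε.2⁻¹ • σε.1)

/-- The subgraph of `G` in which each agent is connected to its neighbours with the same choice. -/
def clusterGraph {V : Type*} {k : ℕ} (G : SimpleGraph V) (a : V → Fin k) : SimpleGraph V where
  Adj i j := G.Adj i j ∧ a i = a j
  symm := ⟨fun _ _ h => ⟨h.1.symm, h.2.symm⟩⟩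
  loopless := ⟨fun _ h => h.1.ne rfl⟩

namespace Data

variable {V : Type*} [Fintype V] {d k : ℕ}

/-- Leader election: agent `i` is the leader. -/
def isLeader (P : Data V d k) (i : V) : Prop :=
  maxConsensus P.graph (fun _ => P.nBound) P.uid i = P.uid i

open Classical in
/-- Network size calculation: the value `n_i` computed by agent `i`. -/
def size (P : Data V d k) (i : V) : ℝ :=
  1 / ftaConsensus P.graph (fun _ => P.nBound) (P.prep .networkSize)
    (fun j => if P.isLeader j then (1 : ℝ) else 0) i

/-- `n_i` as the integer with which agent `i` runs the consensus procedures of the main cycle. -/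
def sizeNat (P : Data V d k) (i : V) : ℕ := ⌊P.size i⌋₊

open Classical in
/-- State of the agents after the initialization. -/
def dInit (P : Data V d k) : DState V d k where
  received := fun _ _ _ => ⊥
  choice := fun _ => none
  cnbhd := fun i => nbhd P.graph i
  centroid := fun i j => if P.isLeader i then toExt (P.cInit j) else fun _ => ⊥
  nu := fun _ => none
  exit := fun _ => False

/-- Centroid propagation. -/
def dReceived (P : Data V d k) (s : DState V d k) : V → Fin k → Fin d → EReal :=
  maxConsensus P.graph P.sizeNat fun i =>
    match s.choice i with
    | none => s.centroid i
    | some a => propInit a (s.centroid i a)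

/-- Nearest centroid choice at step `T + 1`, after receiving the centroids `c`. -/
def dChoice (P : Data V d k) (T : ℕ) (c : V → Fin k → Fin d → EReal) : V → Fin k :=
  fun i => P.tie T i (argminSet fun j => extDist (c i j) (P.x i))

/-- Sub-cluster centroid identification: the value `SCC_i`. -/
def scc (P : Data V d k) (T : ℕ) (a : V → Fin k) : V → EuclideanSpace ℝ (Fin d) :=
  ftaConsensus (clusterGraph P.graph a) P.sizeNat (P.prep (.subCentroid T)) P.x

/-- Sub-cluster leader election: agent `i` is the leader of its sub-cluster. -/
def isSubLeader (P : Data V d k) (a : V → Fin k) (i : V) : Prop :=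
  maxConsensus (clusterGraph P.graph a) P.sizeNat P.uid i = P.uid i

open Classical in
/-- Sub-cluster size calculation: the value `SCS_i`. -/
def scs (P : Data V d k) (T : ℕ) (a : V → Fin k) (i : V) : ℝ :=
  1 / ftaConsensus (clusterGraph P.graph a) P.sizeNat (P.prep (.subSize T))
    (fun j => if P.isSubLeader a j then (1 : ℝ) else 0) i

open Classical in
/-- Initial condition `η_i⁰ = e_a ⊗ (σ_i, ε_i)`, `a` being the choice of agent `i`. -/
def etaInit (P : Data V d k) (T : ℕ) (a : V → Fin k) (i : V) :
    Fin k → EuclideanSpace ℝ (Fin d) × ℝ :=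
  Pi.single (a i)
    (if P.isSubLeader a i then (P.scs T a i • P.scc T a i, P.scs T a i) else (0, 0))

/-- Centroid calculation. -/
def dCentroid (P : Data V d k) (T : ℕ) (a : V → Fin k) : V → Fin k → Fin d → EReal :=
  fun i j => extQuot (ftaConsensus P.graph P.sizeNat (P.prep (.centroid T)) (P.etaInit T a) i j)

open Classical in
/-- The value `ν̄_i` for the previous choices `a'`, the choices `a` and the new centroids `c`. -/
def dNu (P : Data V d k) (T : ℕ) (a' : V → Option (Fin k)) (a : V → Fin k)
    (c : V → Fin k → Fin d → EReal) (i : V) : ℝ :=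
  match P.rule with
  | .assignments =>
    maxConsensus P.graph P.sizeNat (fun j => if a' j = some (a j) then (0 : ℝ) else 1) i
  | _ =>
    ftaConsensus P.graph P.sizeNat (P.prep (.exitValue T))
      (fun j => P.size j * ‖ofExt (c j (a j)) - P.x j‖ ^ 2) i

/-- Exit condition, from the previous value of `ν̄_i` (if any) and the present one. -/
def dExit (P : Data V d k) (prev : Option ℝ) (ν : ℝ) : Prop :=
  match P.rule with
  | .assignments => ν = 0
  | .objective Δ => ∃ ν', prev = some ν' ∧ ν - ν' < Δ
  | .objectiveAbs Δ => ∃ ν', prev = some ν' ∧ |ν - ν'| < Δ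

open Classical in
/-- Step `T + 1` of the main cycle, executed synchronously by all agents. -/
def dStep (P : Data V d k) (T : ℕ) (s : DState V d k) : DState V d k :=
  let c := P.dReceived s
  let a := P.dChoice T c
  let c' := P.dCentroid (T + 1) a
  let ν := P.dNu (T + 1) s.choice a c'
  { received := c
    choice := fun i => some (a i)
    cnbhd := fun i => (nbhd P.graph i).filter fun j => a j = a i
    centroid := c'
    nu := fun i => some (ν i)
    exit := fun i => P.dExit (s.nu i) (ν i) }

/-- Variables of the agents at the end of step `T` of the main cycle (`T = 0`: after the
initialization). -/
def dState (P : Data V d k) : ℕ → DState V d k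
  | 0 => P.dInit
  | T + 1 => P.dStep T (P.dState T)

/-- Number of steps executed by agent `i`, according to its own exit flag. -/
def dStop (P : Data V d k) (i : V) : ℕ := stopStep P.M fun T => (P.dState T).exit i

end Data

open Classical in
/-- Objective `∑_i ∑_j r_ij ‖x_i - c_ij‖²` for the choices and the centroids held by the agents. -/
def dObjective {V : Type*} [Fintype V] {d k : ℕ} (x : V → EuclideanSpace ℝ (Fin d))
    (c : V → Fin k → Fin d → EReal) (choice : V → Option (Fin k)) : ℝ :=
  ∑ i, ∑ j, (if choice i = some j then (1 : ℝ) else 0) * ‖x i - ofExt (c i j)‖ ^ 2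

end

end DistKMeans

/-! The distributed algorithm simulates the centralized one exactly, because every consensus call
returns an exact value: with a common bound `m` at least the number of agents, max-consensus gives
the maximum over the agent's component (`maxConsensus_isLUB`) and the finite-time procedure gives
the mean over it (`ftaConsensus_eq`).

For the mean, the iteration matrix is W = 1 - L/m with L the graph Laplacian, hence symmetric. Agent
i sees a run z only through the pairings ⟨W^s e_i, z⟩, and the independent preparatory runs make its
columns as informative as the vectors W^s e_i, so q_i is the minimal polynomial of e_i under W.
Pairing q_i(W) e_i = 0 with the constant vector gives q_i(1) = 0, and symmetry makes this root
simple. The vector u = p_i(W) e_i is fixed by W, so constant on components; testing it against their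
indicators gives p_i(1)/|C| on the component C of i and 0 elsewhere. No limit or spectral bound
enters.

Sub-clusters are the components of `clusterGraph`. Each has one leader, which holds the sum and the
number of its observations; averaging over the connected graph therefore gives the sum and size of
each whole cluster, up to a factor 1/n that cancels in the quotient (`dCentroid_eq`). A nonempty
cluster has a member that propagates its centroid, and an empty one stays at -∞. Distances and their
squares have the same minimizers, so the common tie rule gives equal choices, and induction on the
step concludes (`dState_succ`). -/

namespace DistKMeans

/-! ### Max-consensus and leader election -/

section MaxConsensus

variable {V α : Type*} [Fintype V] [SemilatticeSup α]

lemma mem_nbhd {H : SimpleGraph V} {i j : V} : j ∈ nbhd H i ↔ H.Adj i j := by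
  simp [nbhd]

lemma iterate_maxRound_le {H : SimpleGraph V} {z : V → α} {u : α} (t : ℕ) :
    ∀ i, (∀ j, H.Reachable i j → z j ≤ u) → ((maxRound H)^[t] z) i ≤ u := by
  classical
  induction t with
  | zero => intro i h; exact h i (SimpleGraph.Reachable.refl i)
  | succ t ih =>
    intro i h
    rw [Function.iterate_succ_apply']
    refine Finset.sup'_le _ _ fun j hj => ih j fun l hl => h l ?_
    rcases Finset.mem_insert.1 hj with rfl | hj
    · exact hl
    · exact (mem_nbhd.1 hj).reachable.trans hl

lemma le_iterate_maxRound {H : SimpleGraph V} {z : V → α} (t : ℕ) :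
    ∀ {i j : V} (p : H.Walk i j), p.length ≤ t → z j ≤ ((maxRound H)^[t] z) i := by
  classical
  induction t with
  | zero =>
    intro i j p hp
    have := SimpleGraph.Walk.eq_of_length_eq_zero (Nat.le_zero.1 hp)
    subst this
    exact le_rfl
  | succ t ih =>
    intro i j p hp
    rw [Function.iterate_succ_apply']
    cases p with
    | nil =>
      refine (ih (SimpleGraph.Walk.nil : H.Walk i i) (Nat.zero_le _)).trans ?_
      unfold maxRound
      exact Finset.le_sup' _ (by simp)
    | @cons _ l _ h q =>
      refine (ih q (by simpa using hp)).trans ?_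
      have hl : l ∈ nbhd H i := mem_nbhd.2 h
      unfold maxRound
      exact Finset.le_sup' ((maxRound H)^[t] z) (Finset.mem_insert_of_mem hl)

/-- After at least `card V` rounds every agent holds the maximum over its connected component. -/
theorem maxConsensus_isLUB {H : SimpleGraph V} {N : V → ℕ} {z : V → α} {i : V}
    (hN : Fintype.card V ≤ N i) :
    IsLUB {y | ∃ j, H.Reachable i j ∧ z j = y} (maxConsensus H N z i) := by
  constructor
  · rintro _ ⟨j, hj, rfl⟩
    obtain ⟨p, hp⟩ := hj.exists_isPath
    -- A path repeats no vertex, so it is shorter than `card V`; this is where the bound on the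
    -- number of rounds enters.
    exact le_iterate_maxRound _ p (hp.length_lt.le.trans hN)
  · intro u hu
    exact iterate_maxRound_le _ _ fun j hj => hu ⟨j, hj, rfl⟩

lemma maxConsensus_eq_of_isGreatest {H : SimpleGraph V} {N : V → ℕ} {z : V → α} {i l : V}
    (hN : Fintype.card V ≤ N i) (hl : H.Reachable i l) (h : ∀ j, H.Reachable i j → z j ≤ z l) :
    maxConsensus H N z i = z l :=
  (maxConsensus_isLUB hN).unique
    (IsGreatest.isLUB ⟨⟨l, hl, rfl⟩, by rintro _ ⟨j, hj, rfl⟩; exact h j hj⟩)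

/-- Every connected component has exactly one agent whose identifier is the result of
max-consensus. -/
theorem existsUnique_leader {H : SimpleGraph V} {N : V → ℕ} {uid : V → ℕ}
    (huid : Function.Injective uid) (hN : ∀ i, Fintype.card V ≤ N i) (i : V) :
    ∃! l, H.Reachable i l ∧ maxConsensus H N uid l = uid l := by
  classical
  obtain ⟨l, hl, hmax⟩ := Finset.exists_max_image (Finset.univ.filter fun j => H.Reachable i j) uid
    ⟨i, by simp⟩
  simp only [Finset.mem_filter, Finset.mem_univ, true_and] at hl hmax
  have key : ∀ j, H.Reachable i j → maxConsensus H N uid j = uid l := fun j hj =>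
    maxConsensus_eq_of_isGreatest (hN j) (hj.symm.trans hl) fun m hm => hmax m (hj.trans hm)
  refine ⟨l, ⟨hl, key l hl⟩, fun m hm => huid ?_⟩
  rw [← hm.2, key m hm.1]

end MaxConsensus

/-! ### Finite-time average consensus through minimal polynomials -/

section AverageConsensus

variable {V : Type*} [Fintype V]

/-- Component of agent `i`. -/
noncomputable def component (H : SimpleGraph V) (i : V) : Finset V := by
  classical exact Finset.univ.filter fun j => H.Reachable i j

lemma mem_component {H : SimpleGraph V} {i j : V} : j ∈ component H i ↔ H.Reachable i j := by
  simp [component]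

lemma component_card_pos (H : SimpleGraph V) (i : V) : 0 < (component H i).card :=
  Finset.card_pos.2 ⟨i, mem_component.2 (SimpleGraph.Reachable.refl i)⟩

/-- The linear iteration with a common bound `m`, as an endomorphism. -/
noncomputable def avgLin (H : SimpleGraph V) (m : ℕ) : Module.End ℝ (V → ℝ) where
  toFun := avgRound H fun _ => m
  map_add' f g := by
    ext i
    simp only [avgRound, Pi.add_apply, smul_add, Finset.sum_add_distrib]
    abel
  map_smul' c f := by
    ext i
    simp only [avgRound, Pi.smul_apply, smul_eq_mul, RingHom.id_apply, mul_add, Finset.mul_sum]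
    congr 1
    · ring
    · exact Finset.sum_congr rfl fun _ _ => by ring

lemma avgLin_apply (H : SimpleGraph V) (m : ℕ) (f : V → ℝ) (i : V) :
    avgLin H m f i = f i - (m : ℝ)⁻¹ * ∑ j ∈ nbhd H i, (f i - f j) := by
  change avgRound H (fun _ => m) f i = _
  simp only [avgRound, nbrWeight, smul_eq_mul, Finset.sum_const, nsmul_eq_mul,
    Finset.sum_sub_distrib, ← Finset.mul_sum]
  ring

lemma avgLin_pow_apply (H : SimpleGraph V) (m : ℕ) (f : V → ℝ) (t : ℕ) :
    (avgLin H m ^ t) f = avgIter H (fun _ => m) f t := by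
  rw [Module.End.pow_apply]
  rfl

/-- The iteration matrix is symmetric. -/
lemma sum_smul_avgRound {E : Type*} [AddCommGroup E] [Module ℝ E] (H : SimpleGraph V) (m : ℕ)
    (f : V → ℝ) (z : V → E) :
    ∑ i, f i • avgRound H (fun _ => m) z i = ∑ i, avgLin H m f i • z i := by
  classical
  change _ = ∑ i, avgRound H (fun _ => m) f i • z i
  simp only [avgRound, smul_add, add_smul, Finset.sum_add_distrib]
  congr 1
  · exact Finset.sum_congr rfl fun i _ => by rw [smul_smul, smul_eq_mul, mul_comm]
  · simp only [nbhd, Finset.sum_filter, Finset.smul_sum, Finset.sum_smul]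
    rw [Finset.sum_comm]
    refine Finset.sum_congr rfl fun i _ => Finset.sum_congr rfl fun j _ => ?_
    by_cases h : H.Adj i j
    · rw [if_pos h, if_pos h.symm, smul_smul, nbrWeight, smul_eq_mul, mul_comm, nbrWeight]
    · rw [if_neg h, if_neg fun h' => h h'.symm, smul_zero, zero_smul]

lemma sum_smul_avgIter {E : Type*} [AddCommGroup E] [Module ℝ E] (H : SimpleGraph V) (m : ℕ)
    (z : V → E) (t : ℕ) (f : V → ℝ) :
    ∑ i, f i • avgIter H (fun _ => m) z t i = ∑ i, (avgLin H m ^ t) f i • z i := by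
  induction t generalizing f with
  | zero => simp [avgIter]
  | succ t ih =>
    have : avgIter H (fun _ => m) z (t + 1)
        = avgRound H (fun _ => m) (avgIter H (fun _ => m) z t) := by
      simp only [avgIter, Function.iterate_succ_apply']
    rw [this, sum_smul_avgRound, ih, pow_succ]
    rfl

/-- Row i of W^t is W^t e_i by symmetry, so the Krylov vectors of e_i carry everything that agent i
observes. -/
lemma avgIter_eq_sum {E : Type*} [AddCommGroup E] [Module ℝ E] [DecidableEq V]
    (H : SimpleGraph V) (m : ℕ) (z : V → E) (t : ℕ) (i : V) :
    avgIter H (fun _ => m) z t i = ∑ j, (avgLin H m ^ t) (Pi.single i 1) j • z j := by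
  rw [← sum_smul_avgIter, Finset.sum_eq_single i] <;> simp +contextual

lemma dotProduct_avgLin (H : SimpleGraph V) (m : ℕ) (f g : V → ℝ) :
    f ⬝ᵥ avgLin H m g = avgLin H m f ⬝ᵥ g := by
  exact sum_smul_avgRound H m f g

lemma dotProduct_aeval_avgLin (H : SimpleGraph V) (m : ℕ) (p : Polynomial ℝ) (f g : V → ℝ) :
    f ⬝ᵥ Polynomial.aeval (avgLin H m) p g = Polynomial.aeval (avgLin H m) p f ⬝ᵥ g := by
  have hpow : ∀ t : ℕ, f ⬝ᵥ (avgLin H m ^ t) g = (avgLin H m ^ t) f ⬝ᵥ g := fun t => by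
    have := sum_smul_avgIter H m g t f
    rw [avgLin_pow_apply H m g]
    simpa [dotProduct] using this
  simp only [Polynomial.aeval_eq_sum_range, LinearMap.sum_apply, LinearMap.smul_apply,
    dotProduct_sum, sum_dotProduct, dotProduct_smul, smul_dotProduct, hpow]

/-- Since W = 1 - L/m, fixed vectors are the kernel of the Laplacian. -/
lemma avgLin_eq_self_iff {H : SimpleGraph V} {m : ℕ} (hm : m ≠ 0) {f : V → ℝ} :
    avgLin H m f = f ↔ ∀ i j, H.Reachable i j → f i = f j := by
  classical
  rw [← H.lapMatrix_mulVec_eq_zero_iff_forall_reachable, funext_iff, funext_iff]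
  refine forall_congr' fun i => ?_
  have hnb : H.neighborFinset i = nbhd H i := by ext; simp [nbhd]
  rw [avgLin_apply, SimpleGraph.lapMatrix_mulVec_apply, Finset.sum_sub_distrib, Finset.sum_const,
    nsmul_eq_mul, ← hnb, SimpleGraph.card_neighborFinset_eq_degree]
  simp [hm]

lemma aeval_apply_of_apply_eq_self {E : Type*} [AddCommGroup E] [Module ℝ E] {W : Module.End ℝ E}
    {f : E} (h : W f = f) (p : Polynomial ℝ) : Polynomial.aeval W p f = p.eval 1 • f := by
  have hpow : ∀ t : ℕ, (W ^ t) f = f := fun t => by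
    rw [Module.End.pow_apply]; exact Function.iterate_fixed h t
  simp only [Polynomial.aeval_eq_sum_range, LinearMap.sum_apply, LinearMap.smul_apply, hpow,
    Polynomial.eval_eq_sum_range, one_pow, mul_one, Finset.sum_smul]

/-- Linear dependence among the first Krylov vectors means that a polynomial of bounded degree
annihilates the vector. -/
lemma not_linearIndependent_pow_iff {E : Type*} [AddCommGroup E] [Module ℝ E] (W : Module.End ℝ E)
    (e : E) (n : ℕ) :
    (¬ LinearIndependent ℝ fun s : Fin (n + 1) => (W ^ (s : ℕ)) e) ↔
      ∃ p : Polynomial ℝ, p ≠ 0 ∧ p.natDegree ≤ n ∧ Polynomial.aeval W p e = 0 := by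
  rw [Fintype.not_linearIndependent_iff]
  constructor
  · rintro ⟨g, hg, i, hi⟩
    have hcoeff : ∀ j : Fin (n + 1),
        (∑ s : Fin (n + 1), Polynomial.monomial (s : ℕ) (g s)).coeff j = g j := by
      intro j
      rw [Polynomial.finsetSum_coeff, Finset.sum_eq_single j]
      · simp
      · intro s _ hs
        rw [Polynomial.coeff_monomial, if_neg fun h => hs (Fin.ext h)]
      · simp
    refine ⟨∑ s : Fin (n + 1), Polynomial.monomial (s : ℕ) (g s), fun h => hi ?_, ?_, ?_⟩
    · rw [← hcoeff i, h, Polynomial.coeff_zero]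
    · exact Polynomial.natDegree_sum_le_of_forall_le _ _ fun s _ =>
        (Polynomial.natDegree_monomial_le _).trans (Nat.lt_succ_iff.1 s.2)
    · simpa [Polynomial.aeval_monomial, Module.algebraMap_end_apply] using hg
  · rintro ⟨p, hp, hdeg, hpe⟩
    refine ⟨fun s => p.coeff s, ?_, ⟨p.natDegree, Nat.lt_succ_iff.2 hdeg⟩, ?_⟩
    · rw [Polynomial.aeval_eq_sum_range' (Nat.lt_succ_iff.2 hdeg)] at hpe
      rw [← Finset.sum_range fun s => p.coeff s • (W ^ s) e]
      simpa using hpe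
    · simpa using hp

variable [DecidableEq V]

/-- Runs of the linear iteration, as seen by an agent, from the states `prep 0, …, prep (m - 1)`. -/
noncomputable def observation (prep : ℕ → V → ℝ) (m : ℕ) : (V → ℝ) →ₗ[ℝ] (Fin m → ℝ) where
  toFun v j := v ⬝ᵥ prep j
  map_add' v w := by ext; simp [add_dotProduct]
  map_smul' c v := by ext; simp [smul_dotProduct]

omit [DecidableEq V] in
-- The first `card V` preparatory states already span, so a vector orthogonal to all of them
-- vanishes.
lemma ker_observation {prep : ℕ → V → ℝ} {m : ℕ} (hm : Fintype.card V ≤ m)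
    (hprep : LinearIndependent ℝ fun j : Fin (Fintype.card V) => prep j) :
    LinearMap.ker (observation prep m) = ⊥ := by
  rw [LinearMap.ker_eq_bot']
  intro v hv
  have hspan := hprep.span_eq_top_of_card_eq_finrank' (by simp)
  have : ∀ w : V → ℝ, v ⬝ᵥ w = 0 := by
    intro w
    have hw : w ∈ Submodule.span ℝ (Set.range fun j : Fin (Fintype.card V) => prep j) := by
      rw [hspan]; trivial
    induction hw using Submodule.span_induction with
    | mem w h =>
      obtain ⟨j, rfl⟩ := h
      exact congrFun hv ⟨j, j.2.trans_le hm⟩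
    | zero => simp
    | add a b _ _ ha hb => rw [dotProduct_add, ha, hb, add_zero]
    | smul c a _ ha => rw [dotProduct_smul, ha, smul_zero]
  exact dotProduct_self_eq_zero.1 (this v)

lemma prepColumn_eq (H : SimpleGraph V) (m : ℕ) (prep : ℕ → V → ℝ) (i : V) (s : ℕ) :
    prepColumn H (fun _ => m) prep i s =
      observation prep m ((avgLin H m ^ s) (Pi.single i 1)) := by
  ext j
  simp only [prepColumn, avgIter_eq_sum, observation, LinearMap.coe_mk, AddHom.coe_mk, dotProduct,
    smul_eq_mul]

section

variable {H : SimpleGraph V} {m : ℕ} {prep : ℕ → V → ℝ} (hm : Fintype.card V ≤ m)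
  (hprep : LinearIndependent ℝ fun j : Fin (Fintype.card V) => prep j) (i : V)

include hm hprep

lemma not_linearIndependent_prepColumn_iff (n : ℕ) :
    (¬ LinearIndependent ℝ fun s : Fin (n + 1) => prepColumn H (fun _ => m) prep i s) ↔
      ∃ p : Polynomial ℝ, p ≠ 0 ∧ p.natDegree ≤ n ∧
        Polynomial.aeval (avgLin H m) p (Pi.single i 1) = 0 := by
  rw [← not_linearIndependent_pow_iff]
  simp only [prepColumn_eq]
  exact not_congr (LinearMap.linearIndependent_iff _ (ker_observation hm hprep))

/-- Minimality of q_i. A nonzero constant cannot annihilate e_i, so the degree is positive and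
subtracting one from it does not truncate. -/
lemma degIndex_le_of_aeval_eq_zero {p : Polynomial ℝ} (hp : p ≠ 0)
    (h : Polynomial.aeval (avgLin H m) p (Pi.single i 1) = 0) :
    degIndex H (fun _ => m) prep i + 1 ≤ p.natDegree := by
  have hpos : p.natDegree ≠ 0 := by
    intro h0
    rw [Polynomial.eq_C_of_natDegree_eq_zero h0, Polynomial.aeval_C] at h
    have := congrFun h i
    simp only [Module.algebraMap_end_apply, Pi.smul_apply, Pi.single_eq_same, smul_eq_mul, mul_one,
      Pi.zero_apply] at this
    apply hp
    rw [Polynomial.eq_C_of_natDegree_eq_zero h0, this, Polynomial.C_0]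
  have : degIndex H (fun _ => m) prep i ≤ p.natDegree - 1 := by
    refine Nat.sInf_le ?_
    exact (not_linearIndependent_prepColumn_iff hm hprep i _).2 ⟨p, hp, by omega, h⟩
  omega

lemma agentPoly_spec :
    (agentPoly H (fun _ => m) prep i).Monic ∧
      (agentPoly H (fun _ => m) prep i).natDegree = degIndex H (fun _ => m) prep i + 1 ∧
      Polynomial.aeval (avgLin H m) (agentPoly H (fun _ => m) prep i) (Pi.single i 1) = 0 := by
  set δ := degIndex H (fun _ => m) prep i with hδ
  -- Any m + 2 vectors of ℝ^m are dependent, so the infimum defining `degIndex` is attained rather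
  -- than the default 0.
  have hne : {δ : ℕ | ¬ LinearIndependent ℝ fun s : Fin (δ + 2) =>
      prepColumn H (fun _ => m) prep i s}.Nonempty := by
    refine ⟨m, fun h => ?_⟩
    have := h.fintype_card_le_finrank
    simp at this
  obtain ⟨p, hp0, hpdeg, hp⟩ := (not_linearIndependent_prepColumn_iff hm hprep i _).1
    (Nat.sInf_mem hne)
  have hsum : ∀ q : Polynomial ℝ, q.natDegree = δ + 1 →
      ((∑ s ∈ Finset.range (δ + 2), q.coeff s • prepColumn H (fun _ => m) prep i s = 0) ↔
        Polynomial.aeval (avgLin H m) q (Pi.single i 1) = 0) := by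
    intro q hq
    rw [← (LinearMap.ker_eq_bot.1 (ker_observation hm hprep)).eq_iff,
      Polynomial.aeval_eq_sum_range' (n := δ + 2) (by omega), map_zero]
    simp only [prepColumn_eq, LinearMap.sum_apply, LinearMap.smul_apply, map_sum, map_smul]
  -- `agentPoly` is an `epsilon` choice, so its properties need a witness: an annihilator of least
  -- degree, made monic.
  have hex : ∃ q : Polynomial ℝ, q.Monic ∧ q.natDegree = δ + 1 ∧
      ∑ s ∈ Finset.range (δ + 2), q.coeff s • prepColumn H (fun _ => m) prep i s = 0 := by
    have hdeg : (p * Polynomial.C p.leadingCoeff⁻¹).natDegree = δ + 1 := by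
      rw [Polynomial.natDegree_mul_C (inv_ne_zero (Polynomial.leadingCoeff_ne_zero.2 hp0))]
      exact le_antisymm hpdeg (degIndex_le_of_aeval_eq_zero hm hprep i hp0 hp)
    refine ⟨_, Polynomial.monic_mul_leadingCoeff_inv hp0, hdeg, (hsum _ hdeg).2 ?_⟩
    rw [mul_comm, map_mul, Module.End.mul_apply, hp, map_zero]
  obtain ⟨h1, h2, h3⟩ := Classical.epsilon_spec hex
  exact ⟨h1, h2, (hsum _ h2).1 h3⟩

/-- The constant vector is fixed by W and has pairing 1 with e_i, so its pairing with q_i(W) e_i = 0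
is q_i(1). -/
lemma agentPoly_eval_one : (agentPoly H (fun _ => m) prep i).eval 1 = 0 := by
  have hm0 : m ≠ 0 := by have := Fintype.card_pos_iff.2 ⟨i⟩; omega
  obtain ⟨-, -, hq⟩ := agentPoly_spec (H := H) hm hprep i
  have h := dotProduct_aeval_avgLin H m (agentPoly H (fun _ => m) prep i) (Pi.single i 1)
    (fun _ => 1)
  rw [hq, aeval_apply_of_apply_eq_self
    ((avgLin_eq_self_iff (f := fun _ => (1 : ℝ)) hm0).2 fun _ _ _ => rfl)] at h
  simpa using h

lemma X_sub_one_mul_agentQuot :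
    (Polynomial.X - Polynomial.C 1) * agentQuot H (fun _ => m) prep i =
      agentPoly H (fun _ => m) prep i :=
  Polynomial.mul_divByMonic_eq_iff_isRoot.2 (agentPoly_eval_one hm hprep i)

lemma natDegree_agentQuot :
    (agentQuot H (fun _ => m) prep i).natDegree = degIndex H (fun _ => m) prep i := by
  rw [agentQuot, Polynomial.natDegree_divByMonic _ (Polynomial.monic_X_sub_C _),
    (agentPoly_spec hm hprep i).2.1, Polynomial.natDegree_X_sub_C]
  omega

lemma agentQuot_ne_zero : agentQuot H (fun _ => m) prep i ≠ 0 := by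
  intro h
  have := X_sub_one_mul_agentQuot (H := H) hm hprep i
  rw [h, mul_zero] at this
  exact (agentPoly_spec hm hprep i).1.ne_zero this.symm

lemma avgLin_aeval_agentQuot :
    avgLin H m (Polynomial.aeval (avgLin H m) (agentQuot H (fun _ => m) prep i) (Pi.single i 1)) =
      Polynomial.aeval (avgLin H m) (agentQuot H (fun _ => m) prep i) (Pi.single i 1) := by
  have h := (agentPoly_spec (H := H) hm hprep i).2.2
  rw [← X_sub_one_mul_agentQuot hm hprep i, map_mul, Module.End.mul_apply] at h
  simpa [sub_eq_zero] using h

/-- The eigenvalue one is a simple root of the polynomial, because the iteration matrix is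
symmetric. -/
lemma agentQuot_eval_one_ne_zero : (agentQuot H (fun _ => m) prep i).eval 1 ≠ 0 := by
  intro h0
  set p := agentQuot H (fun _ => m) prep i with hp
  set W := avgLin H m with hW
  obtain ⟨h, hh⟩ := Polynomial.dvd_iff_isRoot.2 h0
  set u := Polynomial.aeval W p (Pi.single i 1) with hu
  have hWu : W u = u := avgLin_aeval_agentQuot hm hprep i
  have huw : u = W (Polynomial.aeval W h (Pi.single i 1)) -
      Polynomial.aeval W h (Pi.single i 1) := by
    rw [hu, hh, map_mul, Module.End.mul_apply]
    simp
  -- u lies in both the kernel and the range of the symmetric operator W - 1, hence is orthogonal to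
  -- itself.
  have hzero : u ⬝ᵥ u = 0 := by
    nth_rw 2 [huw]
    rw [dotProduct_sub, dotProduct_avgLin, hWu, sub_self]
  have hu0 : u = 0 := dotProduct_self_eq_zero.1 hzero
  -- Now p_i annihilates e_i with degree one below the minimum.
  have := degIndex_le_of_aeval_eq_zero (H := H) hm hprep i (agentQuot_ne_zero hm hprep i) hu0
  rw [natDegree_agentQuot hm hprep i] at this
  omega

/-- The finite-time procedure returns to each agent the mean of the initial states over its
connected component. -/
theorem ftaConsensus_eq {E : Type*} [AddCommGroup E] [Module ℝ E] (z : V → E) :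
    ftaConsensus H (fun _ => m) prep z i =
      ((component H i).card : ℝ)⁻¹ • ∑ j ∈ component H i, z j := by
  classical
  have hm0 : m ≠ 0 := by have := Fintype.card_pos_iff.2 ⟨i⟩; omega
  set p := agentQuot H (fun _ => m) prep i with hp
  have hp1 : p.eval 1 ≠ 0 := agentQuot_eval_one_ne_zero hm hprep i
  set u := Polynomial.aeval (avgLin H m) p (Pi.single i 1) with hu
  have hWu : avgLin H m u = u := avgLin_aeval_agentQuot hm hprep i
  have hconst := (avgLin_eq_self_iff hm0).1 hWu
  -- Moving p_i(W) across the pairing onto a fixed vector g turns it into the scalar p_i(1).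
  have htest : ∀ g : V → ℝ, avgLin H m g = g → u ⬝ᵥ g = p.eval 1 * g i := by
    intro g hg
    rw [hu, ← dotProduct_aeval_avgLin, aeval_apply_of_apply_eq_self hg]
    simp
  have hsupp : ∀ j, j ∉ component H i → u j = 0 := by
    intro j hj
    -- The test vector is the indicator of the component of j, which does not contain i.
    have h1 := htest (fun l => if H.Reachable j l then 1 else 0) <| by
      rw [avgLin_eq_self_iff hm0]
      intro a b hab
      exact if_congr ⟨fun h => h.trans hab, fun h => h.trans hab.symm⟩ rfl rfl
    rw [if_neg fun h => hj (mem_component.2 h.symm), mul_zero] at h1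
    have h2 : u ⬝ᵥ (fun l => if H.Reachable j l then (1 : ℝ) else 0) =
        (component H j).card * u j := by
      simp only [dotProduct, mul_ite, mul_one, mul_zero, ← Finset.sum_filter]
      rw [Finset.sum_congr (s₂ := component H j) (by ext; simp [mem_component])
        (g := fun _ => u j) (fun l hl => (hconst _ _ (mem_component.1 hl)).symm)]
      simp
    rw [h2] at h1
    exact (mul_eq_zero.1 h1).resolve_left (Nat.cast_ne_zero.2 (component_card_pos H j).ne')
  have hval : ((component H i).card : ℝ) * u i = p.eval 1 := by
    have h1 := htest (fun _ => 1) ((avgLin_eq_self_iff hm0).2 fun _ _ _ => rfl)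
    rw [mul_one] at h1
    rw [← h1, dotProduct, ← Finset.sum_subset (Finset.subset_univ (component H i))
      (fun j _ hj => by rw [hsupp j hj, zero_mul]),
      Finset.sum_congr rfl (g := fun _ => u i) (fun j hj => by
        rw [mul_one, hconst _ _ (mem_component.1 hj)])]
    simp
  have hfta : ftaConsensus H (fun _ => m) prep z i = (p.eval 1)⁻¹ • ∑ j, u j • z j := by
    rw [hu, Polynomial.aeval_eq_sum_range, natDegree_agentQuot hm hprep i, ftaConsensus, ← hp]
    simp only [LinearMap.sum_apply, Finset.sum_apply, Finset.sum_smul, Finset.smul_sum,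
      LinearMap.smul_apply, Pi.smul_apply, avgIter_eq_sum, smul_smul, smul_eq_mul]
    rw [Finset.sum_comm]
    refine Finset.sum_congr rfl fun j _ => Finset.sum_congr rfl fun s _ => ?_
    congr 1
    ring
  have hci : ((component H i).card : ℝ) ≠ 0 := Nat.cast_ne_zero.2 (component_card_pos H i).ne'
  rw [hfta, ← Finset.sum_subset (Finset.subset_univ (component H i))
      (fun j _ hj => by rw [hsupp j hj, zero_smul]), Finset.smul_sum, Finset.smul_sum]
  refine Finset.sum_congr rfl fun j hj => ?_
  rw [smul_smul, ← hconst _ _ (mem_component.1 hj), ← hval]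
  congr 1
  have hui : u i ≠ 0 := fun h => hp1 (by rw [← hval, h, mul_zero])
  field_simp

end

end AverageConsensus

/-! ### Sums over components with one leader each -/

section Components

variable {V : Type*} [Fintype V] {H : SimpleGraph V}

lemma component_eq_univ (hH : H.Connected) (i : V) : component H i = Finset.univ := by
  ext j
  simp [mem_component, hH.preconnected i j]

variable {L : V → Prop} [DecidablePred L] (hL : ∀ i, ∃! l, H.Reachable i l ∧ L l)

include hL

/-- Makes the mean of the leader indicator 1/|C|, whose reciprocal is the component size. -/
lemma sum_component_indicator (i : V) :
    ∑ l ∈ component H i, (if L l then (1 : ℝ) else 0) = 1 := by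
  obtain ⟨l, ⟨hil, hl⟩, huniq⟩ := hL i
  rw [Finset.sum_eq_single l]
  · rw [if_pos hl]
  · intro m hm hne
    exact if_neg fun h => hne (huniq m ⟨mem_component.1 hm, h⟩)
  · intro h
    exact absurd (mem_component.2 hil) h

/-- Summing over one representative of each component the sums over the components gives the sum
over all vertices. -/
lemma sum_leader_sum_component {E : Type*} [AddCommGroup E] (f : V → E) :
    ∑ i, (if L i then ∑ l ∈ component H i, f l else 0) = ∑ l, f l := by
  classical
  have h1 : ∀ i, (if L i then ∑ l ∈ component H i, f l else 0) =
      ∑ l, if L i ∧ H.Reachable i l then f l else 0 := by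
    intro i
    by_cases hi : L i
    · simp only [hi, if_true, true_and, ← Finset.sum_filter]
      exact Finset.sum_congr (by ext; simp [mem_component]) fun _ _ => rfl
    · simp [hi]
  simp only [h1]
  rw [Finset.sum_comm]
  refine Finset.sum_congr rfl fun l _ => ?_
  obtain ⟨m, ⟨hlm, hm⟩, huniq⟩ := hL l
  rw [Finset.sum_eq_single m]
  · exact if_pos ⟨hm, hlm.symm⟩
  · intro i _ hne
    exact if_neg fun h => hne (huniq i ⟨h.2.symm, h.1⟩)
  · intro h
    exact absurd (Finset.mem_univ m) h

end Components

lemma eq_of_reachable_clusterGraph {V : Type*} {k : ℕ} {G : SimpleGraph V} {a : V → Fin k}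
    {i j : V} (h : (clusterGraph G a).Reachable i j) : a i = a j := by
  obtain ⟨p⟩ := h
  induction p with
  | nil => rfl
  | cons h _ ih => exact h.2.trans ih

/-! ### Undefined centroids and nearest-centroid sets -/

section ExtendedVectors

variable {d k : ℕ}

@[simp] lemma ofExt_toExt (v : EuclideanSpace ℝ (Fin d)) : ofExt (toExt v) = v := by
  ext l
  simp [ofExt, toExt]

/-- For d = 0 the empty vector would be vacuously finite, hence `hd`. -/
lemma extDist_optToExt_none (hd : 1 ≤ d) (y : EuclideanSpace ℝ (Fin d)) :
    extDist (optToExt none) y = ⊤ :=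
  if_neg fun h => (h ⟨0, hd⟩).1 rfl

lemma extDist_optToExt_some (v y : EuclideanSpace ℝ (Fin d)) :
    extDist (optToExt (some v)) y = ((‖y - v‖ : ℝ) : EReal) := by
  rw [extDist, if_pos fun l => ⟨EReal.coe_ne_bot _, EReal.coe_ne_top _⟩, norm_sub_rev]
  simp [optToExt]

lemma extDist_le_iff_sqDist_le (hd : 1 ≤ d) (y : EuclideanSpace ℝ (Fin d))
    (c c' : Option (EuclideanSpace ℝ (Fin d))) :
    extDist (optToExt c) y ≤ extDist (optToExt c') y ↔ sqDist y c ≤ sqDist y c' := by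
  cases c' with
  | none => simp [extDist_optToExt_none hd, sqDist]
  | some v' =>
    cases c with
    | none => simp only [extDist_optToExt_none hd, extDist_optToExt_some, sqDist, top_le_iff,
        EReal.coe_ne_top]
    | some v =>
      simp only [extDist_optToExt_some, sqDist, EReal.coe_le_coe_iff]
      exact (sq_le_sq₀ (norm_nonneg _) (norm_nonneg _)).symm

lemma argminSet_extDist (hd : 1 ≤ d) (y : EuclideanSpace ℝ (Fin d))
    (c : Fin k → Option (EuclideanSpace ℝ (Fin d))) :
    (argminSet fun j => extDist (optToExt (c j)) y) = argminSet fun j => sqDist y (c j) := by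
  simp only [argminSet, extDist_le_iff_sqDist_le hd]

lemma argminSet_nonempty (hk : 1 ≤ k) (f : Fin k → EReal) : (argminSet f).Nonempty := by
  have : Nonempty (Fin k) := ⟨⟨0, hk⟩⟩
  obtain ⟨j, hj⟩ := Finite.exists_min f
  exact ⟨j, by simpa [argminSet] using hj⟩

/-- Adding `⊥` in `EReal` always gives `⊥`, so unchosen blocks are erased even if `c` has infinite
entries. -/
lemma propInit_apply (a j : Fin k) (c : Fin d → EReal) :
    propInit a c j = if j = a then c else fun _ => ⊥ := by
  ext l
  by_cases h : j = a <;> simp [propInit, mu, muHat, h]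

lemma toReal_sqDist {y : EuclideanSpace ℝ (Fin d)} {c : Option (EuclideanSpace ℝ (Fin d))}
    (hc : c ≠ none) : (sqDist y c).toReal = ‖y - ofExt (optToExt c)‖ ^ 2 := by
  obtain ⟨v, rfl⟩ := Option.ne_none_iff_exists'.1 hc
  rw [sqDist, EReal.toReal_coe, optToExt, ofExt_toExt]

end ExtendedVectors

/-! ### The objective -/

section Objective

variable {V : Type*} [Fintype V] {d k : ℕ} {x : V → EuclideanSpace ℝ (Fin d)} {a : V → Fin k}
  {c : Fin k → Option (EuclideanSpace ℝ (Fin d))}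

lemma sum_r_ne_zero_iff {j : Fin k} : ∑ i, r (a i) j ≠ 0 ↔ ∃ i, a i = j := by
  rw [Ne, Finset.sum_eq_zero_iff_of_nonneg fun i _ => by unfold r; split_ifs <;> norm_num]
  simp [r]

lemma refine_ne_none_iff {j : Fin k} : refine x a j ≠ none ↔ ∃ i, a i = j := by
  rw [← sum_r_ne_zero_iff]
  unfold refine
  split_ifs with h <;> simp [h]

/-- `hc` excludes a mismatch of default values: an undefined centroid has `⊤.toReal = 0` on the
left, but `ofExt` sends it to the origin on the right. -/
lemma objective_eq (hc : ∀ i, c (a i) ≠ none) :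
    objective x c a = ∑ i, ‖x i - ofExt (optToExt (c (a i)))‖ ^ 2 := by
  refine Finset.sum_congr rfl fun i _ => ?_
  rw [Finset.sum_eq_single (a i)]
  · rw [r, if_pos rfl, one_mul, toReal_sqDist (hc i)]
  · intro j _ hj
    rw [r, if_neg hj.symm, zero_mul]
  · intro h
    exact absurd (Finset.mem_univ _) h

lemma dObjective_eq (hc : ∀ i, c (a i) ≠ none) :
    dObjective x (fun _ j => optToExt (c j)) (fun i => some (a i)) = objective x c a := by
  rw [objective_eq hc]
  refine Finset.sum_congr rfl fun i _ => ?_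
  rw [Finset.sum_eq_single (a i)]
  · rw [if_pos rfl, one_mul]
  · intro j _ hj
    rw [if_neg fun h => hj (Option.some.inj h).symm, zero_mul]
  · intro h
    exact absurd (Finset.mem_univ _) h

end Objective

lemma stopStep_spec {M : ℕ} (hM : 1 ≤ M) (e : ℕ → Prop) : 1 ≤ stopStep M e :=
  (Nat.sInf_mem (s := {T : ℕ | 1 ≤ T ∧ (M ≤ T ∨ e T)}) ⟨M, hM, Or.inl le_rfl⟩).1

lemma stopStep_congr {M : ℕ} {e e' : ℕ → Prop} (h : ∀ T, e (T + 1) ↔ e' (T + 1)) :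
    stopStep M e = stopStep M e' := by
  unfold stopStep
  congr 1
  ext T
  cases T with
  | zero => simp
  | succ T => simp [h T]

/-! ### The phases of one distributed step -/

namespace Data

variable {V : Type*} [Fintype V] {d k : ℕ}

/-- The standing assumptions on the network: connected graph, distinct identifiers, a valid bound on
the number of agents, and independent preparatory runs. -/
structure WellPosed (P : Data V d k) : Prop where
  connected : P.graph.Connected
  uid_injective : Function.Injective P.uid
  card_le : Fintype.card V ≤ P.nBound
  prep_independent : ∀ call : FTACall,
    LinearIndependent ℝ fun j : Fin (Fintype.card V) => P.prep call j

namespace WellPosed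

variable {P : Data V d k} (hP : P.WellPosed)

include hP

lemma existsUnique_isLeader (i : V) : ∃! l, P.graph.Reachable i l ∧ P.isLeader l :=
  existsUnique_leader hP.uid_injective (fun _ => hP.card_le) i

lemma card_pos : 0 < Fintype.card V :=
  have := hP.connected.nonempty
  Fintype.card_pos

theorem size_eq (i : V) : P.size i = Fintype.card V := by
  classical
  rw [size, ftaConsensus_eq hP.card_le (hP.prep_independent _),
    sum_component_indicator hP.existsUnique_isLeader, component_eq_univ hP.connected]
  simp

/-- From here on all agents share the exact bound n, as the uniform-bound results require. -/
theorem sizeNat_eq : P.sizeNat = fun _ => Fintype.card V := by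
  ext i
  rw [sizeNat, hP.size_eq, Nat.floor_natCast]

lemma ftaConsensus_graph {E : Type*} [AddCommGroup E] [Module ℝ E] (call : FTACall) (z : V → E)
    (i : V) :
    ftaConsensus P.graph P.sizeNat (P.prep call) z i = (Fintype.card V : ℝ)⁻¹ • ∑ j, z j := by
  classical
  rw [hP.sizeNat_eq, ftaConsensus_eq le_rfl (hP.prep_independent _),
    component_eq_univ hP.connected, Finset.card_univ]

lemma maxConsensus_graph_isLUB {α : Type*} [SemilatticeSup α] (z : V → α) (i : V) :
    IsLUB (Set.range z) (maxConsensus P.graph P.sizeNat z i) := by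
  have h := maxConsensus_isLUB (H := P.graph) (N := P.sizeNat) (z := z) (i := i)
    (by rw [hP.sizeNat_eq])
  convert h using 1
  ext y
  simp [hP.connected.preconnected i _]

/-- Different blocks may attain their maximum at different agents, so no single agent need hold the
maximum; blocks at -∞ need no witness. -/
lemma maxConsensus_graph_eq {z : V → Fin k → Fin d → EReal} {u : Fin k → Fin d → EReal}
    (hle : ∀ i j, z i j ≤ u j) (hex : ∀ j, u j = (fun _ => ⊥) ∨ ∃ i, z i j = u j) (i : V) :
    maxConsensus P.graph P.sizeNat z i = u := by
  refine (hP.maxConsensus_graph_isLUB z i).unique ⟨?_, ?_⟩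
  · rintro _ ⟨m, rfl⟩
    exact hle m
  · intro w hw j
    rcases hex j with h | ⟨m, hm⟩
    · rw [h]
      exact fun _ => bot_le
    · rw [← hm]
      exact hw ⟨m, rfl⟩ j

lemma dReceived_dInit : P.dReceived P.dInit = fun _ j => optToExt (some (P.cInit j)) := by
  ext1 i
  have := hP.connected.nonempty
  refine hP.maxConsensus_graph_eq (fun m j => ?_) (fun j => Or.inr ?_) i
  · by_cases hm : P.isLeader m
    · simp [dInit, hm, optToExt]
    · simp only [dInit, hm, if_false]
      exact fun _ => bot_le
  · obtain ⟨l, ⟨-, hl⟩, -⟩ := hP.existsUnique_isLeader (Classical.arbitrary V)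
    exact ⟨l, by simp [dInit, hl, optToExt]⟩

/-- Blocks with a member are sent by that member; the others were undefined already, so erasing them
loses nothing. -/
lemma dReceived_of_refine {s : DState V d k} {a : V → Fin k}
    (ha : s.choice = fun i => some (a i))
    (hc : s.centroid = fun _ j => optToExt (refine P.x a j)) :
    P.dReceived s = fun _ j => optToExt (refine P.x a j) := by
  ext1 i
  refine hP.maxConsensus_graph_eq (fun m j => ?_) (fun j => ?_) i
  · simp only [ha, hc, propInit_apply]
    split_ifs with h
    · rw [h]
    · exact fun _ => bot_le
  · by_cases hj : ∃ m, a m = j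
    · obtain ⟨m, rfl⟩ := hj
      exact Or.inr ⟨m, by simp only [ha, hc, propInit_apply, if_true]⟩
    · left
      rw [not_not.1 (mt refine_ne_none_iff.1 hj)]
      rfl

lemma existsUnique_isSubLeader (a : V → Fin k) (i : V) :
    ∃! l, (clusterGraph P.graph a).Reachable i l ∧ P.isSubLeader a l :=
  existsUnique_leader hP.uid_injective (fun _ => by rw [hP.sizeNat_eq]) i

lemma scc_eq (T : ℕ) (a : V → Fin k) (i : V) :
    P.scc T a i = ((component (clusterGraph P.graph a) i).card : ℝ)⁻¹ •
      ∑ l ∈ component (clusterGraph P.graph a) i, P.x l := by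
  classical
  rw [scc, hP.sizeNat_eq, ftaConsensus_eq le_rfl (hP.prep_independent _)]

lemma scs_eq (T : ℕ) (a : V → Fin k) (i : V) :
    P.scs T a i = (component (clusterGraph P.graph a) i).card := by
  classical
  rw [scs, hP.sizeNat_eq, ftaConsensus_eq le_rfl (hP.prep_independent _),
    sum_component_indicator (hP.existsUnique_isSubLeader a)]
  simp

-- Writes a leader's contribution as a sum over its sub-cluster, the form needed by
-- `sum_leader_sum_component`. The choice is constant on the sub-cluster, so the inner condition is
-- uniform.
open Classical in
lemma etaInit_apply (T : ℕ) (a : V → Fin k) (i : V) (j : Fin k) :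
    P.etaInit T a i j = if P.isSubLeader a i then
      ∑ l ∈ component (clusterGraph P.graph a) i,
        (if a l = j then (P.x l, (1 : ℝ)) else 0) else 0 := by
  have hne : ((component (clusterGraph P.graph a) i).card : ℝ) ≠ 0 :=
    Nat.cast_ne_zero.2 (component_card_pos _ i).ne'
  have hsum : ∑ l ∈ component (clusterGraph P.graph a) i,
      (if a l = j then (P.x l, (1 : ℝ)) else 0) =
      if a i = j then ∑ l ∈ component (clusterGraph P.graph a) i, (P.x l, (1 : ℝ)) else 0 := by
    rw [Finset.sum_congr rfl (g := fun l => if a i = j then (P.x l, (1 : ℝ)) else 0)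
      fun l hl => by rw [eq_of_reachable_clusterGraph (mem_component.1 hl)]]
    split_ifs <;> simp
  rw [hsum, etaInit]
  by_cases hj : a i = j
  · subst hj
    rw [Pi.single_eq_same, if_pos rfl]
    congr 1
    rw [hP.scc_eq, hP.scs_eq, smul_smul, mul_inv_cancel₀ hne, one_smul]
    ext1 <;> simp [Prod.fst_sum, Prod.snd_sum]
  · rw [Pi.single_eq_of_ne' hj, if_neg hj]
    simp

theorem dCentroid_eq (T : ℕ) (a : V → Fin k) :
    P.dCentroid T a = fun _ j => optToExt (refine P.x a j) := by
  classical
  ext1 i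
  ext1 j
  have hn : (Fintype.card V : ℝ) ≠ 0 := Nat.cast_ne_zero.2 hP.card_pos.ne'
  have hsum : (∑ i, P.etaInit T a i) j = (∑ i, r (a i) j • P.x i, ∑ i, r (a i) j) := by
    rw [Finset.sum_apply]
    simp only [hP.etaInit_apply]
    rw [sum_leader_sum_component (hP.existsUnique_isSubLeader a)]
    ext1
    · simp only [Prod.fst_sum]
      refine Finset.sum_congr rfl fun l _ => ?_
      by_cases h : a l = j <;> simp [r, h]
    · simp only [Prod.snd_sum]
      refine Finset.sum_congr rfl fun l _ => ?_
      by_cases h : a l = j <;> simp [r, h]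
  rw [dCentroid, hP.ftaConsensus_graph, Pi.smul_apply, hsum, extQuot, refine]
  -- The factor 1/n is nonzero, so the averaged size vanishes exactly for an empty cluster; below it
  -- cancels in the quotient.
  simp only [Prod.smul_mk, smul_eq_mul, mul_eq_zero, inv_eq_zero, hn, false_or]
  split_ifs with h
  · rfl
  · rw [optToExt, smul_smul]
    congr 2
    field_simp

/-- The factor n_i = n undoes the averaging, and an agent's own cluster is never empty. -/
lemma dNu_objective (hrule : P.rule ≠ .assignments) (T : ℕ) (a' : V → Option (Fin k))
    (a : V → Fin k) (i : V) :
    P.dNu T a' a (fun _ j => optToExt (refine P.x a j)) i = objective P.x (refine P.x a) a := by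
  have hn : (Fintype.card V : ℝ) ≠ 0 := Nat.cast_ne_zero.2 hP.card_pos.ne'
  have h : P.dNu T a' a (fun _ j => optToExt (refine P.x a j)) i =
      ftaConsensus P.graph P.sizeNat (P.prep (.exitValue T))
        (fun j => P.size j * ‖ofExt (optToExt (refine P.x a (a j))) - P.x j‖ ^ 2) i := by
    unfold dNu
    split
    · exact absurd ‹_› hrule
    · rfl
  rw [h, hP.ftaConsensus_graph, objective_eq fun m => refine_ne_none_iff.2 ⟨m, rfl⟩, Finset.smul_sum]
  refine Finset.sum_congr rfl fun m _ => ?_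
  rw [hP.size_eq, smul_eq_mul, inv_mul_cancel_left₀ hn, norm_sub_rev]

lemma dNu_assignments_eq_zero_iff (hrule : P.rule = .assignments) (T : ℕ)
    (a' : V → Option (Fin k)) (a : V → Fin k) (c : V → Fin k → Fin d → EReal) (i : V) :
    P.dNu T a' a c i = 0 ↔ a' = fun m => some (a m) := by
  classical
  have h : P.dNu T a' a c i =
      maxConsensus P.graph P.sizeNat (fun j => if a' j = some (a j) then (0 : ℝ) else 1) i := by
    unfold dNu
    rw [hrule]
  have hlub := hP.maxConsensus_graph_isLUB (fun j => if a' j = some (a j) then (0 : ℝ) else 1) i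
  rw [h]
  constructor
  · intro h0
    rw [h0] at hlub
    ext1 m
    by_contra hm
    have := hlub.1 ⟨m, rfl⟩
    simp only [hm, if_false] at this
    linarith
  · intro ha
    refine hlub.unique ?_
    simp only [ha, if_true]
    have := hP.connected.nonempty
    rw [Set.range_const]
    exact isLUB_singleton

end WellPosed

/-! ### Agreement with the centralized algorithm and exit tests -/

variable (P : Data V d k)

lemma dStep_choice (hd : 1 ≤ d) {T : ℕ} {s : DState V d k}
    (h : P.dReceived s = fun _ j => optToExt (P.kCentroid T j)) :
    P.dChoice T (P.dReceived s) = P.kAssign T := by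
  ext1 i
  rw [h, dChoice, argminSet_extDist hd]
  rfl

variable {P}

/-- The variables of the agents agree with those of the centralized algorithm at every step. -/
theorem WellPosed.dState_succ (hP : P.WellPosed) (hd : 1 ≤ d) (T : ℕ) :
    (P.dState (T + 1)).received = (fun _ j => optToExt (P.kCentroid T j)) ∧
    (P.dState (T + 1)).choice = (fun i => some (P.kAssign T i)) ∧
    (P.dState (T + 1)).centroid = (fun _ j => optToExt (P.kCentroid (T + 1) j)) := by
  have hstep : ∀ T, P.dReceived (P.dState T) = (fun _ j => optToExt (P.kCentroid T j)) →
      (P.dState (T + 1)).received = (fun _ j => optToExt (P.kCentroid T j)) ∧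
      (P.dState (T + 1)).choice = (fun i => some (P.kAssign T i)) ∧
      (P.dState (T + 1)).centroid = (fun _ j => optToExt (P.kCentroid (T + 1) j)) := by
    intro T h
    refine ⟨h, ?_, ?_⟩
    · simp only [dState, dStep, P.dStep_choice hd h]
    · simp only [dState, dStep, P.dStep_choice hd h, hP.dCentroid_eq]
      rfl
  induction T with
  | zero => exact hstep 0 hP.dReceived_dInit
  | succ T ih => exact hstep (T + 1) (hP.dReceived_of_refine ih.2.1 ih.2.2)

lemma WellPosed.dReceived_dState (hP : P.WellPosed) (hd : 1 ≤ d) (T : ℕ) :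
    P.dReceived (P.dState T) = fun _ j => optToExt (P.kCentroid T j) :=
  (hP.dState_succ hd T).1

lemma WellPosed.dState_succ_nu (hP : P.WellPosed) (hd : 1 ≤ d) (hrule : P.rule ≠ .assignments)
    (T : ℕ) : (P.dState (T + 1)).nu = fun _ => some (P.kObjective T) := by
  ext1 i
  simp only [dState, dStep, P.dStep_choice hd (hP.dReceived_dState hd T), hP.dCentroid_eq,
    hP.dNu_objective hrule]
  rfl

theorem WellPosed.dState_succ_exit_iff (hP : P.WellPosed) (hd : 1 ≤ d) (T : ℕ) (i : V) :
    (P.dState (T + 1)).exit i ↔ P.kExit (T + 1) := by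
  have hexit : (P.dState (T + 1)).exit i ↔ P.dExit ((P.dState T).nu i)
      (P.dNu (T + 1) (P.dState T).choice (P.kAssign T)
        (fun _ j => optToExt (refine P.x (P.kAssign T) j)) i) := by
    simp only [dState, dStep, P.dStep_choice hd (hP.dReceived_dState hd T), hP.dCentroid_eq]
  rw [hexit]
  by_cases hrule : P.rule = .assignments
  · have h : ∀ p ν, P.dExit p ν ↔ ν = 0 := fun p ν => by unfold dExit; rw [hrule]
    rw [h, hP.dNu_assignments_eq_zero_iff hrule]
    cases T with
    | zero =>
      -- The initial choice `none` differs from every cluster index, so the first step never exits.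
      simp only [dState, dInit, kExit, iff_false]
      exact fun h => Option.some_ne_none _ (congrFun h i).symm
    | succ T =>
      rw [(hP.dState_succ hd T).2.1]
      have h2 : P.kExit (T + 1 + 1) ↔ P.kAssign (T + 1) = P.kAssign T := by
        unfold kExit; rw [hrule]
      rw [h2]
      simp only [funext_iff, Option.some.injEq, eq_comm]
  · rw [hP.dNu_objective hrule]
    cases T with
    | zero =>
      have : (P.dState 0).nu i = none := rfl
      rw [this]
      unfold dExit kExit
      split
      · exact absurd ‹_› hrule
      all_goals simp
    | succ T =>
      rw [hP.dState_succ_nu hd hrule]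
      unfold dExit kExit
      cases hr : P.rule with
      | assignments => exact absurd hr hrule
      | objective Δ => simp [kObjective]; rfl
      | objectiveAbs Δ => simp [kObjective]; rfl

/-- Some centroid is always defined, initially or as the mean of a cluster with a member, so a
nearest one is at finite distance. -/
lemma kCentroid_kAssign_ne_none [Nonempty V] (P : Data V d k) (hk : 1 ≤ k)
    (htie : ∀ (T : ℕ) (i : V) (s : Finset (Fin k)), s.Nonempty → P.tie T i s ∈ s) (T : ℕ) (i : V) :
    P.kCentroid T (P.kAssign T i) ≠ none := by
  have hex : ∃ j, P.kCentroid T j ≠ none := by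
    cases T with
    | zero => exact ⟨⟨0, hk⟩, Option.some_ne_none _⟩
    | succ T => exact ⟨_, refine_ne_none_iff.2 ⟨Classical.arbitrary V, rfl⟩⟩
  obtain ⟨j, hj⟩ := hex
  obtain ⟨v, hv⟩ := Option.ne_none_iff_exists'.1 hj
  have hmem : P.kAssign T i ∈ argminSet fun j => sqDist (P.x i) (P.kCentroid T j) :=
    htie T i _ (argminSet_nonempty hk _)
  simp only [argminSet, Finset.mem_filter, Finset.mem_univ, true_and] at hmem
  intro hnone
  have := hmem j
  rw [hnone, hv] at this
  simp only [sqDist, top_le_iff] at this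
  exact EReal.coe_ne_top _ this

end Data

end DistKMeans

theorem theorem1 {V : Type*} [Fintype V] {d k : ℕ} (hd : 1 ≤ d) (hk : 1 ≤ k)
    (P : DistKMeans.Data V d k)
    (hG : P.graph.Connected)
    (huid : Function.Injective P.uid)
    (hn : Fintype.card V ≤ P.nBound)
    (hprep : ∀ call : DistKMeans.FTACall,
      LinearIndependent ℝ (fun j : Fin (Fintype.card V) => P.prep call j))
    (htie : ∀ (T : ℕ) (i : V) (s : Finset (Fin k)), s.Nonempty → P.tie T i s ∈ s)
    (hM : 1 ≤ P.M) :
    (∀ T : ℕ,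
      (∀ i j, (P.dState (T + 1)).received i j = DistKMeans.optToExt (P.kCentroid T j)) ∧
      (∀ i, (P.dState (T + 1)).choice i = some (P.kAssign T i)) ∧
      (∀ i j, (P.dState (T + 1)).centroid i j = DistKMeans.optToExt (P.kCentroid (T + 1) j)) ∧
      DistKMeans.dObjective P.x (P.dState (T + 1)).received (P.dState (T + 1)).choice =
        DistKMeans.objective P.x (P.kCentroid T) (P.kAssign T) ∧
      DistKMeans.dObjective P.x (P.dState (T + 1)).centroid (P.dState (T + 1)).choice =
        DistKMeans.objective P.x (P.kCentroid (T + 1)) (P.kAssign T) ∧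
      (∀ i, (P.dState (T + 1)).exit i ↔ P.kExit (T + 1))) ∧
    (∀ i, P.dStop i = P.kStop ∧
      (∀ j, (P.dState (P.dStop i)).centroid i j = DistKMeans.optToExt (P.kCentroid P.kStop j)) ∧
      (P.dState (P.dStop i)).choice i = some (P.kAssign (P.kStop - 1) i) ∧
      (∀ l, l ∈ (P.dState (P.dStop i)).cnbhd i ↔
        P.graph.Adj i l ∧ P.kAssign (P.kStop - 1) l = P.kAssign (P.kStop - 1) i)) := by
  have hP : P.WellPosed := ⟨hG, huid, hn, hprep⟩
  have := hG.nonempty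
  refine ⟨fun T => ?_, fun i => ?_⟩
  · obtain ⟨h1, h2, h3⟩ := hP.dState_succ hd T
    refine ⟨fun i j => by rw [h1], fun i => by rw [h2], fun i j => by rw [h3], ?_, ?_,
      fun i => hP.dState_succ_exit_iff hd T i⟩
    · rw [h1, h2]
      exact DistKMeans.dObjective_eq (P.kCentroid_kAssign_ne_none hk htie T)
    · rw [h3, h2]
      exact DistKMeans.dObjective_eq fun i => DistKMeans.refine_ne_none_iff.2 ⟨i, rfl⟩
  · have hsteps : P.dStop i = P.kStop :=
      DistKMeans.stopStep_congr fun T => hP.dState_succ_exit_iff hd T i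
    -- The stopping step is positive, so it is S + 1, whose choices are those of iteration S.
    obtain ⟨S, hS⟩ := Nat.exists_eq_add_of_le' (DistKMeans.stopStep_spec hM P.kExit)
    have hS : P.kStop = S + 1 := hS
    obtain ⟨-, h2, h3⟩ := hP.dState_succ hd S
    refine ⟨hsteps, ?_, ?_, ?_⟩
    · intro j
      rw [hsteps, hS, h3]
    · rw [hsteps, hS, h2, Nat.add_sub_cancel]
    · intro l
      rw [hsteps, hS, Nat.add_sub_cancel]
      simp only [DistKMeans.Data.dState, DistKMeans.Data.dStep,
        P.dStep_choice hd (hP.dReceived_dState hd S), Finset.mem_filter, DistKMeans.mem_nbhd]
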